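/- For a formal variable $q$ and an integer $r\ge 1$ let $E(q^r)=\prod_{m\ge 1}(1-q^{rm})$. For an integer $\ell\ge 1$ let $p_{\ell,3}(n)$ be the number of 2-color partition triples of $n$ in which one of the colors appears only in parts that are multiples of $\ell$; that is, $p_{\ell,3}(n)$ is defined by $$\sum_{n\ge 0}p_{\ell,3}(n)q^n=\frac{1}{E(q)^3\,E(q^\ell)^3}.$$ Theorem. For all integers $n,\alpha,\beta\ge 0$, $$p_{3^{2\alpha+1},3}\left(3^{2\alpha+\beta+1}n+\frac{4\cdot 3^{2\alpha+\beta+1}+3^{2\alpha+1}+1}{8}\right)\equiv 0 \pmod{3^{3\alpha+\beta+2}}.$$ Moreover, for all integers $n,\alpha,\beta,k\ge 0$ and every odd prime $p$ such that the Legendre symbol satisfies $\left(\frac{-3}{p}\right)=-1$ and such that $p\nmid n$, $$p_{3^{2\alpha+1},3}\left(3^{2\alpha+\beta+1}p^{2k+1}n+\frac{4p^{2k+2}\cdot 3^{2\alpha+\beta+1}+3^{2\alpha+1}+1}{8}\right)\equiv 0 \pmod{3^{3\alpha+\beta+4}}.$$ -/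

import Mathlib

/-- `eulerE r` is the formal power series `E(q^r) = ∏_{m ≥ 1} (1 - q^(r m))` with integer
coefficients. The product is taken in the coefficientwise topology on `ℤ⟦q⟧`; it converges for
every `r ≥ 1` (`multipliable_eulerE`). -/
noncomputable def eulerE (r : ℕ) : PowerSeries ℤ :=
  open scoped PowerSeries.WithPiTopology in
  ∏' m : ℕ, (1 - (PowerSeries.X : PowerSeries ℤ) ^ (r * (m + 1)))

/-- The number `p_{ℓ,3}(n)` of 2-color partition triples of `n`, one of whose colors appears only
in parts that are multiples of `ℓ` (for `ℓ ≥ 1`): the coefficient of `q^n` in the formal power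
series `1 / (E(q)^3 E(q^ℓ)^3)`. The denominator has constant term `1`
(`constantCoeff_eulerE`), and `PowerSeries.invOfUnit _ 1` is the inverse of such a series
(`twoColorTriples_spec`). -/
noncomputable def twoColorTriples (l n : ℕ) : ℤ :=
  PowerSeries.coeff n (PowerSeries.invOfUnit (eulerE 1 ^ 3 * eulerE l ^ 3) 1)

open scoped PowerSeries.WithPiTopology in
theorem multipliable_eulerE {r : ℕ} (hr : 1 ≤ r) :
    Multipliable fun m : ℕ => 1 - (PowerSeries.X : PowerSeries ℤ) ^ (r * (m + 1)) := by
  simp_rw [sub_eq_add_neg]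
  apply PowerSeries.WithPiTopology.multipliable_one_add_of_tendsto_order_atTop_nhds_top
  refine ENat.tendsto_nhds_top_iff_natCast_lt.mpr
    (fun n => Filter.eventually_atTop.mpr ⟨n, fun m hm => ?_⟩)
  rw [PowerSeries.order_neg, PowerSeries.order_X_pow]
  norm_cast
  nlinarith

open scoped PowerSeries.WithPiTopology in
theorem constantCoeff_eulerE {r : ℕ} (hr : 1 ≤ r) :
    PowerSeries.constantCoeff (eulerE r) = 1 := by
  rw [eulerE, (multipliable_eulerE hr).map_tprod _
    (PowerSeries.WithPiTopology.continuous_constantCoeff ℤ)]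
  have h : r ≠ 0 := by omega
  simp [h]

/-- The generating function identity `(∑ p_{ℓ,3}(n) q^n) E(q)^3 E(q^ℓ)^3 = 1`. -/
theorem twoColorTriples_spec {l : ℕ} (hl : 1 ≤ l) :
    PowerSeries.mk (twoColorTriples l) * (eulerE 1 ^ 3 * eulerE l ^ 3) = 1 := by
  have h : PowerSeries.mk (twoColorTriples l)
      = PowerSeries.invOfUnit (eulerE 1 ^ 3 * eulerE l ^ 3) 1 := by
    ext n
    simp [twoColorTriples]
  rw [h]
  apply PowerSeries.invOfUnit_mul
  simp [constantCoeff_eulerE le_rfl, constantCoeff_eulerE hl]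

/-- The divisions by `8` in the theorem are exact: take `c = 1`, or `c = p ^ (2 * k + 2)` with `p`
an odd prime. -/
theorem eight_dvd_offset (a b c : ℕ) (hc : Odd c) :
    8 ∣ 4 * c * 3 ^ (2 * a + b + 1) + 3 ^ (2 * a + 1) + 1 := by
  obtain ⟨d, hd⟩ := hc.mul ((by decide : Odd 3).pow (n := 2 * a + b + 1))
  have h1 : 3 ^ (2 * a + 1) % 8 = 3 := by
    rw [pow_succ, pow_mul, Nat.mul_mod, Nat.pow_mod]
    norm_num
  have h2 : 4 * c * 3 ^ (2 * a + b + 1) = 4 * (2 * d + 1) := by rw [mul_assoc, hd]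
  omega

/-! Write E = E(q), let U keep the coefficients at multiples of 3 and replace q^3 by q, and put x =
qE(q^9)^3/E^3, z = qE(q^3)^12/E^12. Since q/E^3 = x/E(q^9)^3, extracting the indices 3n + 2 from a
product containing 1/E^3 amounts to applying f ↦ U(xf). Passing from 3^(2α+1) to 3^(2α+3) applies f
↦ U(f) and then f ↦ U(xf); each increment of β applies f ↦ U(xf) once more. The process starts from
U(x) = 9z.

The 3-adic gain comes from a modular equation. Jacobi's identity gives E^3 = P(q^3) - 3qE(q^9)^3,
and taking norms over the cube roots of unity evaluates P^3. Hence z = x + 9x^2 + 27x^3, x is cubic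
over series in q^3, and U sends polynomials in 3x without constant term to such polynomials in 27z.
On polynomials in 9z without constant term, U therefore gains 9 and U(x·) gains 3. The total is
3^(3α+β) times such a polynomial, which is itself divisible by 9.

For the second claim, modulo 81 only the linear term 9cz survives, and E^9 ≡ E(q^3)^3 mod 9 turns
z/(E^3 E(q^3)^3) into qE^3 E(q^3)^3 mod 9. By Jacobi, the latter is supported on values of x^2 +
3y^2, in which a prime with (-3/p) = -1 occurs to an even power. -/

open PowerSeries in
theorem tendsto_prod_eulerE {r : ℕ} (hr : 1 ≤ r) :
    open scoped PowerSeries.WithPiTopology in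
    Filter.Tendsto (fun n => ∏ i ∈ Finset.range n, (1 - (X : PowerSeries ℤ) ^ (r * (i + 1))))
      Filter.atTop (nhds (eulerE r)) := by
  open scoped PowerSeries.WithPiTopology in
  exact (multipliable_eulerE hr).tendsto_prod_tprod_nat

/-! ### Gaussian binomials and a finite Jacobi identity -/

/-- The Gaussian binomial coefficient with base `q`. -/
def gaussBinom {R : Type*} [CommRing R] (q : R) : ℕ → ℕ → R
  | _, 0 => 1
  | 0, _ + 1 => 0
  | n + 1, k + 1 => gaussBinom q n (k + 1) + q ^ (n - k) * gaussBinom q n k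

/-- The `q`-factorial `∏_{1 ≤ i ≤ n} (1 - q^i)`. -/
def qPoch {R : Type*} [CommRing R] (q : R) (n : ℕ) : R :=
  ∏ i ∈ Finset.range n, (1 - q ^ (i + 1))

section
variable {R : Type*} [CommRing R] (q : R)

@[simp] theorem gaussBinom_zero_right (n : ℕ) : gaussBinom q n 0 = 1 := by
  cases n <;> rfl

theorem gaussBinom_succ_succ (n k : ℕ) : gaussBinom q (n + 1) (k + 1)
    = gaussBinom q n (k + 1) + q ^ (n - k) * gaussBinom q n k := rfl

theorem gaussBinom_eq_zero_of_lt : ∀ {n k : ℕ}, n < k → gaussBinom q n k = 0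
  | _, 0, h => by omega
  | 0, _ + 1, _ => rfl
  | n + 1, k + 1, h => by
    rw [gaussBinom_succ_succ, gaussBinom_eq_zero_of_lt (by omega : n < k + 1),
      gaussBinom_eq_zero_of_lt (by omega : n < k)]
    simp

theorem qPoch_succ (n : ℕ) : qPoch q (n + 1) = qPoch q n * (1 - q ^ (n + 1)) :=
  Finset.prod_range_succ _ _

theorem gaussBinom_mul_qPoch : ∀ {n k : ℕ}, k ≤ n →
    gaussBinom q n k * (qPoch q k * qPoch q (n - k)) = qPoch q n
  | n, 0, _ => by simp [qPoch]
  | 0, k + 1, h => by omega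
  | n + 1, k + 1, h => by
    have h2 := gaussBinom_mul_qPoch (n := n) (k := k) (by omega)
    rw [gaussBinom_succ_succ, qPoch_succ q k, qPoch_succ q n]
    have e : n + 1 - (k + 1) = n - k := by omega
    rw [e]
    rcases Nat.lt_or_ge k n with hk | hk
    · have h1 := gaussBinom_mul_qPoch (n := n) (k := k + 1) (by omega)
      obtain ⟨d, rfl⟩ : ∃ d, n = k + 1 + d := ⟨n - (k + 1), by omega⟩
      have e1 : k + 1 + d - k = d + 1 := by omega
      have e2 : k + 1 + d - (k + 1) = d := by omega
      rw [e2, qPoch_succ q k] at h1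
      rw [e1] at h2 ⊢
      have e3 := qPoch_succ q d
      calc _ = gaussBinom q (k + 1 + d) (k + 1) * (qPoch q k * (1 - q ^ (k + 1)) * qPoch q d)
            * (1 - q ^ (d + 1)) + q ^ (d + 1) * (1 - q ^ (k + 1)) *
            (gaussBinom q (k + 1 + d) k * (qPoch q k * qPoch q (d + 1))) := by rw [e3]; ring
        _ = _ := by rw [h1, h2]; ring
    · obtain rfl : k = n := by omega
      rw [gaussBinom_eq_zero_of_lt q (Nat.lt_succ_self k)]
      simp only [Nat.sub_self] at h2 ⊢
      linear_combination (1 - q ^ (k + 1)) * h2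

theorem choose_two_succ (j : ℕ) : (j + 1).choose 2 = j.choose 2 + j := by
  rw [Nat.choose_succ_succ' j 1, Nat.choose_one_right, add_comm]

/-- The `q`-binomial theorem in homogeneous form. -/
theorem prod_sub_pow_mul_eq_sum_gaussBinom (x y : R) (N : ℕ) :
    ∏ i ∈ Finset.range N, (y - q ^ i * x) = ∑ j ∈ Finset.range (N + 1),
      (-1) ^ j * q ^ (j.choose 2) * gaussBinom q N j * x ^ j * y ^ (N - j) := by
  induction N with
  | zero => simp
  | succ N ih =>
    rw [Finset.prod_range_succ, ih, Finset.sum_range_succ' _ (N + 1), mul_sub]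
    have h1 : (∑ j ∈ Finset.range (N + 1),
        (-1) ^ j * q ^ (j.choose 2) * gaussBinom q N j * x ^ j * y ^ (N - j)) * y
        = ∑ j ∈ Finset.range (N + 1), (-1) ^ (j + 1) * q ^ ((j + 1).choose 2)
          * gaussBinom q N (j + 1) * x ^ (j + 1) * y ^ (N - j) + y ^ (N + 1) := by
      rw [Finset.sum_range_succ' _ N, Finset.sum_range_succ _ N,
        gaussBinom_eq_zero_of_lt q (Nat.lt_succ_self N), add_mul, Finset.sum_mul]
      simp only [mul_zero, zero_mul, add_zero]
      congr 1
      · refine Finset.sum_congr rfl fun j hj => ?_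
        rw [Finset.mem_range] at hj
        have : N - j = N - (j + 1) + 1 := by omega
        rw [this, pow_succ y]
        ring
      · simp [pow_succ]
    rw [h1, Finset.sum_mul, add_sub_right_comm, ← Finset.sum_sub_distrib]
    congr 1
    · refine Finset.sum_congr rfl fun j hj => ?_
      rw [Finset.mem_range] at hj
      have e1 : N + 1 - (j + 1) = N - j := by omega
      have e2 : q ^ N = q ^ j * q ^ (N - j) := by rw [← pow_add]; congr 1; omega
      rw [gaussBinom_succ_succ, e1, e2, choose_two_succ]
      ring
    · simp

theorem choose_two_add (a b : ℕ) : (a + b).choose 2 = a.choose 2 + b.choose 2 + a * b := by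
  induction b with
  | zero => simp
  | succ b ih =>
    rw [← add_assoc, choose_two_succ, choose_two_succ, ih]
    ring

theorem prod_pow_sub_pow (n : ℕ) : ∏ i ∈ Finset.range n, (q ^ n - q ^ i)
    = (-1) ^ n * q ^ (n.choose 2) * qPoch q n := by
  rw [← Finset.prod_range_reflect]
  have h : ∀ i ∈ Finset.range n, q ^ n - q ^ (n - 1 - i)
      = (-1) * q ^ (n - 1 - i) * (1 - q ^ (i + 1)) := fun i hi => by
    rw [Finset.mem_range] at hi
    have : q ^ n = q ^ (n - 1 - i) * q ^ (i + 1) := by rw [← pow_add]; congr 1; omega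
    rw [this]; ring
  rw [Finset.prod_congr rfl h, Finset.prod_mul_distrib, Finset.prod_mul_distrib,
    Finset.prod_range_reflect (fun i => q ^ i) n, Finset.prod_pow_eq_pow_sum, Finset.sum_range_id,
    Nat.choose_two_right, qPoch]
  simp

theorem map_gaussBinom {S : Type*} [CommRing S] (φ : R →+* S) :
    ∀ n k : ℕ, φ (gaussBinom q n k) = gaussBinom (φ q) n k
  | n, 0 => by simp
  | 0, k + 1 => map_zero φ
  | n + 1, k + 1 => by
    simp only [gaussBinom_succ_succ, map_add, map_mul, map_pow, map_gaussBinom φ n]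

open Polynomial in
/-- The derivative at `x = 1` of the `q`-binomial theorem for `∏_{i ≤ 2n} (q^n - q^i x)`. -/
theorem sum_mul_gaussBinom (n : ℕ) :
    ∑ j ∈ Finset.range (n + 1 + (n + 1)), (-1) ^ j * j * q ^ (j.choose 2 + n * (2 * n + 1 - j))
        * gaussBinom q (2 * n + 1) j
      = (-1) ^ (n + 1) * q ^ (n.choose 2 + n + n * n) * qPoch q n ^ 2 := by
  have h := congrArg (fun p => (derivative p).eval 1)
    (prod_sub_pow_mul_eq_sum_gaussBinom (C q) X (C (q ^ n)) (n + 1 + n))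
  have hr : ∏ i ∈ Finset.range n, (q ^ n - q ^ (n + 1 + i)) = q ^ (n * n) * qPoch q n := by
    have : ∀ i ∈ Finset.range n, q ^ n - q ^ (n + 1 + i) = q ^ n * (1 - q ^ (i + 1)) :=
      fun i _ => by ring
    rw [Finset.prod_congr rfl this, Finset.prod_mul_distrib, Finset.prod_const, Finset.card_range,
      ← pow_mul, qPoch]
  have hl := prod_pow_sub_pow q n
  simp only [← map_gaussBinom, ← C_pow] at h
  rw [Finset.prod_range_add, Finset.prod_range_succ] at h
  -- The factor i = n vanishes at x = 1, so only the term differentiating it survives.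
  have e (a b : R[X]) : (derivative (a * (C (q ^ n) - C (q ^ n) * X) * b)).eval 1
      = - q ^ n * (a.eval 1 * b.eval 1) := by
    simp [derivative_mul]
    ring
  rw [e, eval_prod, eval_prod, derivative_sum, eval_finsetSum] at h
  simp only [eval_sub, eval_mul, eval_C, eval_X, mul_one] at h
  rw [hl, hr] at h
  have e2 : n + 1 + n + 1 = n + 1 + (n + 1) := by ring
  have e3 : n + 1 + n = 2 * n + 1 := by ring
  rw [e2, e3] at h
  calc _ = _ := Finset.sum_congr rfl fun j _ => ?_
    _ = _ := h.symm
    _ = _ := by ring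
  have e4 : ((-1 : R[X]) ^ j * C (q ^ j.choose 2) * C (gaussBinom q (2 * n + 1) j) * X ^ j
      * C ((q ^ n) ^ (2 * n + 1 - j))) = C ((-1) ^ j * q ^ (j.choose 2)
      * gaussBinom q (2 * n + 1) j * (q ^ n) ^ (2 * n + 1 - j)) * X ^ j := by
    simp only [C_mul, C_pow, C_neg, C_1]
    ring
  rw [e4, derivative_C_mul_X_pow]
  simp only [eval_mul, eval_C, eval_pow, eval_X, one_pow, mul_one, ← pow_mul, pow_add]
  ring

/-- The terms j = n + 1 + k and j = n - k of the differentiated sum carry the same power of q, so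
they can be paired. -/
theorem gaussBinom_symm_aux {n k : ℕ} (hk : k ≤ n) :
    (n + 1 + k).choose 2 + n * (2 * n + 1 - (n + 1 + k))
        = n.choose 2 + n + n * n + (k + 1).choose 2 ∧
      (n - k).choose 2 + n * (2 * n + 1 - (n - k))
        = n.choose 2 + n + n * n + (k + 1).choose 2 := by
  obtain ⟨d, rfl⟩ := Nat.exists_eq_add_of_le hk
  have e1 : 2 * (k + d) + 1 - (k + d + 1 + k) = d := by omega
  have e2 : 2 * (k + d) + 1 - (k + d - k) = 2 * k + d + 1 := by omega
  have e3 : k + d - k = d := by omega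
  have hk2 : k * k = 2 * k.choose 2 + k := by
    clear * -
    induction k with
    | zero => rfl
    | succ k ih => rw [choose_two_succ]; linarith
  constructor
  · rw [e1, choose_two_add (k + d + 1), choose_two_succ, choose_two_add k d, choose_two_succ]
    linarith
  · rw [e2, e3, choose_two_add k d, choose_two_succ]
    linarith

/-- A finite form of Jacobi's identity, up to a power of `q`. -/
theorem pow_mul_sum_gaussBinom (hsymm : ∀ n k, k ≤ n → gaussBinom q (2 * n + 1) (n + 1 + k)
      = gaussBinom q (2 * n + 1) (n - k)) (n : ℕ) :
    q ^ (n.choose 2 + n + n * n) * ∑ k ∈ Finset.range (n + 1),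
        (-1) ^ k * (2 * k + 1) * q ^ ((k + 1).choose 2) * gaussBinom q (2 * n + 1) (n - k)
      = q ^ (n.choose 2 + n + n * n) * qPoch q n ^ 2 := by
  have h := sum_mul_gaussBinom q n
  have e : ∀ a b : R, a = (-1) ^ (n + 1) * b → (-1) ^ (n + 1) * a = b := fun a b h => by
    rw [h, ← mul_assoc, ← mul_pow]; simp
  rw [mul_assoc] at h
  -- Pair j = n - k with j = n + 1 + k: the signs are opposite, so the weights j combine to (n + 1 +
  -- k) - (n - k) = 2k + 1.
  rw [← e _ _ h, Finset.sum_range_add _ (n + 1) (n + 1),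
    ← Finset.sum_range_reflect (fun j : ℕ => (-1) ^ j * (j : R) *
      q ^ (j.choose 2 + n * (2 * n + 1 - j)) * gaussBinom q (2 * n + 1) j) (n + 1),
    ← Finset.sum_add_distrib, Finset.mul_sum, Finset.mul_sum]
  refine Finset.sum_congr rfl fun k hk => ?_
  have hk : k ≤ n := by simpa [Nat.lt_succ_iff] using hk
  obtain ⟨h1, h2⟩ := gaussBinom_symm_aux hk
  have e3 : n + 1 - 1 - k = n - k := by omega
  have e4 : ((n - k : ℕ) : R) = n - k := by push_cast [hk]; ring
  have e5 : (-1 : R) ^ (n + 1) * (-1) ^ (n - k) = - (-1) ^ k := by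
    rw [← pow_add, show n + 1 + (n - k) = 2 * (n - k) + (k + 1) by omega, pow_add, pow_mul]
    simp [pow_succ]
  have e6 : (-1 : R) ^ (n + 1) * (-1) ^ (n + 1 + k) = (-1) ^ k := by
    rw [pow_add _ (n + 1), ← mul_assoc, ← mul_pow]; simp
  rw [e3, h1, h2, hsymm n k hk, e4, pow_add _ _ ((k + 1).choose 2)]
  push_cast
  linear_combination (-(n - k : R) * e5 - (n + 1 + k) * e6) * q ^ (n.choose 2 + n + n * n)
    * q ^ ((k + 1).choose 2) * gaussBinom q (2 * n + 1) (n - k)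
end

/-! ### Jacobi's identity for E(q)^3 -/

open PowerSeries

theorem X_pow_dvd_eulerE_sub_qPoch {m N : ℕ} (h : N ≤ m) :
    (X : PowerSeries ℤ) ^ (N + 1) ∣ eulerE 1 - qPoch X m := by
  have step : ∀ d n, m ≤ n → d ≤ N → coeff d (qPoch (X : PowerSeries ℤ) n)
      = coeff d (qPoch (X : PowerSeries ℤ) m) := by
    intro d n hn hd
    induction n, hn using Nat.le_induction with
    | base => rfl
    | succ n hn ih =>
      rw [qPoch_succ, mul_sub, mul_one, map_sub, coeff_mul_X_pow', if_neg (by omega), sub_zero, ih]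
  rw [X_pow_dvd_iff]
  intro d hd
  have ht := (WithPiTopology.tendsto_iff_coeff_tendsto _ _ _ _).1 (tendsto_prod_eulerE le_rfl) d
  rw [nhds_discrete, Filter.tendsto_pure] at ht
  obtain ⟨n, hn, hmn⟩ := (ht.and (Filter.eventually_ge_atTop m)).exists
  simp only [one_mul] at hn
  rw [map_sub, ← hn, sub_eq_zero]
  exact step d n hmn (by omega)

theorem isUnit_eulerE_one : IsUnit (eulerE 1) :=
  isUnit_iff_constantCoeff.2 (by rw [constantCoeff_eulerE le_rfl]; exact isUnit_one)

theorem qPoch_X_ne_zero (n : ℕ) : qPoch (X : PowerSeries ℤ) n ≠ 0 := by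
  refine Finset.prod_ne_zero_iff.2 fun i _ h => ?_
  simpa using congrArg constantCoeff h

theorem gaussBinom_X_symm {n k : ℕ} (h : k ≤ n) :
    gaussBinom (X : PowerSeries ℤ) (2 * n + 1) (n + 1 + k) = gaussBinom X (2 * n + 1) (n - k) := by
  have h1 := gaussBinom_mul_qPoch (X : PowerSeries ℤ) (show n + 1 + k ≤ 2 * n + 1 by omega)
  have h2 := gaussBinom_mul_qPoch (X : PowerSeries ℤ) (show n - k ≤ 2 * n + 1 by omega)
  rw [show 2 * n + 1 - (n + 1 + k) = n - k by omega] at h1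
  rw [show 2 * n + 1 - (n - k) = n + 1 + k by omega] at h2
  refine mul_right_cancel₀ (mul_ne_zero (qPoch_X_ne_zero (n + 1 + k)) (qPoch_X_ne_zero (n - k))) ?_
  rw [h1, mul_comm (qPoch _ (n + 1 + k)), h2]

/-- The binomial is a quotient of one q-factorial by two others, and all three agree with E(q)
modulo q^(n-k+1). -/
theorem X_pow_dvd_eulerE_mul_gaussBinom {n k : ℕ} (h : k ≤ n) :
    (X : PowerSeries ℤ) ^ (n - k + 1) ∣ eulerE 1 * gaussBinom X (2 * n + 1) (n - k) - 1 := by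
  have h2 := gaussBinom_mul_qPoch (X : PowerSeries ℤ) (show n - k ≤ 2 * n + 1 by omega)
  rw [← isUnit_eulerE_one.dvd_mul_left (u := eulerE 1)]
  have ha := X_pow_dvd_eulerE_sub_qPoch (le_refl (n - k))
  have hb := X_pow_dvd_eulerE_sub_qPoch (show n - k ≤ 2 * n + 1 - (n - k) by omega)
  have hc := X_pow_dvd_eulerE_sub_qPoch (show n - k ≤ 2 * n + 1 by omega)
  obtain ⟨a, ha⟩ := ha
  obtain ⟨b, hb⟩ := hb
  obtain ⟨c, hc⟩ := hc
  generalize gaussBinom (X : PowerSeries ℤ) (2 * n + 1) (n - k) = G at *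
  refine ⟨G * eulerE 1 * b + G * qPoch X (2 * n + 1 - (n - k)) * a - c, ?_⟩
  linear_combination h2 + G * eulerE 1 * hb + G * qPoch X (2 * n + 1 - (n - k)) * ha - hc

/-- Jacobi's identity `E(q)^3 = ∑ (-1)^k (2k+1) q^(k(k+1)/2)`, modulo `q^(n+1)`. -/
theorem X_pow_dvd_eulerE_cube_sub (n : ℕ) :
    (X : PowerSeries ℤ) ^ (n + 1) ∣ eulerE 1 ^ 3 - ∑ k ∈ Finset.range (n + 1),
      (-1) ^ k * (2 * (k : PowerSeries ℤ) + 1) * X ^ ((k + 1).choose 2) := by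
  have h := mul_left_cancel₀ (pow_ne_zero _ X_ne_zero)
    (pow_mul_sum_gaussBinom (X : PowerSeries ℤ) (fun n k h => gaussBinom_X_symm h) n)
  obtain ⟨a, ha⟩ := X_pow_dvd_eulerE_sub_qPoch (le_refl n)
  have e : eulerE 1 ^ 3 = eulerE 1 * qPoch X n ^ 2
      + X ^ (n + 1) * (a * eulerE 1 * (eulerE 1 + qPoch X n)) := by
    linear_combination (eulerE 1 * (eulerE 1 + qPoch X n)) * ha
  rw [e, add_sub_right_comm, ← h, Finset.mul_sum, ← Finset.sum_sub_distrib]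
  refine dvd_add (Finset.dvd_sum fun k hk => ?_) (dvd_mul_right _ _)
  have hk : k ≤ n := by simpa [Nat.lt_succ_iff] using hk
  obtain ⟨b, hb⟩ := X_pow_dvd_eulerE_mul_gaussBinom hk
  -- The binomial is known only modulo q^(n-k+1); the factor q^(k(k+1)/2) supplies the missing k
  -- powers.
  have h1 : k ≤ (k + 1).choose 2 := by rw [choose_two_succ]; omega
  obtain ⟨d, hd⟩ := Nat.exists_eq_add_of_le h1
  refine ⟨(-1) ^ k * (2 * (k : PowerSeries ℤ) + 1) * X ^ d * b, ?_⟩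
  have e2 : (X : PowerSeries ℤ) ^ (n + 1) = X ^ k * X ^ (n - k + 1) := by
    rw [← pow_add]; congr 1; omega
  rw [hd, pow_add, e2]
  linear_combination ((-1) ^ k * (2 * (k : PowerSeries ℤ) + 1) * X ^ k * X ^ d) * hb

theorem strictMono_choose_succ_two : StrictMono fun k : ℕ => (k + 1).choose 2 :=
  strictMono_nat_of_lt_succ fun k => by rw [choose_two_succ (k + 1)]; omega

theorem coeff_eulerE_cube (n : ℕ) : coeff n (eulerE 1 ^ 3) = ∑ k ∈ Finset.range (n + 1),
    if n = (k + 1).choose 2 then (-1) ^ k * (2 * (k : ℤ) + 1) else 0 := by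
  have h := X_pow_dvd_iff.1 (X_pow_dvd_eulerE_cube_sub n) n n.lt_succ_self
  rw [map_sub, sub_eq_zero, map_sum] at h
  rw [h]
  refine Finset.sum_congr rfl fun k _ => ?_
  have : (-1) ^ k * (2 * (k : PowerSeries ℤ) + 1) = C ((-1) ^ k * (2 * (k : ℤ) + 1)) := by simp
  rw [this, coeff_C_mul, coeff_X_pow]
  simp

theorem coeff_choose_eulerE_cube (k : ℕ) :
    coeff ((k + 1).choose 2) (eulerE 1 ^ 3) = (-1) ^ k * (2 * (k : ℤ) + 1) := by
  rw [coeff_eulerE_cube, Finset.sum_eq_single k]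
  · simp
  · intro j _ hj
    exact if_neg fun h => hj (strictMono_choose_succ_two.injective h).symm
  · intro h
    exact absurd (Finset.mem_range.2 (Nat.lt_succ_of_le strictMono_choose_succ_two.le_apply)) h

theorem exists_of_coeff_eulerE_cube_ne_zero {n : ℕ} (h : coeff n (eulerE 1 ^ 3) ≠ 0) :
    ∃ k : ℕ, n = (k + 1).choose 2 := by
  rw [coeff_eulerE_cube] at h
  obtain ⟨k, -, hk⟩ := Finset.exists_ne_zero_of_sum_ne_zero h
  exact ⟨k, by by_contra h; exact hk (if_neg h)⟩

/-! ### Trisection of power series -/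

/-- The substitution `q ↦ q^3`. -/
noncomputable abbrev tri : PowerSeries ℤ →ₐ[ℤ] PowerSeries ℤ := expand 3 three_ne_zero

/-- The series whose coefficients are those at the indices `3n + i`. -/
noncomputable def sec (i : ℕ) : PowerSeries ℤ →+ PowerSeries ℤ where
  toFun f := mk fun n => coeff (3 * n + i) f
  map_zero' := by ext; simp
  map_add' f g := by ext; simp

@[simp] theorem coeff_sec (i n : ℕ) (f : PowerSeries ℤ) :
    coeff n (sec i f) = coeff (3 * n + i) f := by simp [sec]

theorem coeff_tri_combination (a b c : PowerSeries ℤ) (n : ℕ) :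
    coeff (3 * n) (tri a + X * tri b + X ^ 2 * tri c) = coeff n a ∧
    coeff (3 * n + 1) (tri a + X * tri b + X ^ 2 * tri c) = coeff n b ∧
    coeff (3 * n + 2) (tri a + X * tri b + X ^ 2 * tri c) = coeff n c := by
  have h : X * tri b = X ^ 1 * tri b := by rw [pow_one]
  simp only [h, map_add, coeff_X_pow_mul', coeff_expand]
  refine ⟨?_, ?_, ?_⟩
  · have h1 : ¬ (1 ≤ 3 * n ∧ 3 ∣ 3 * n - 1) := by omega
    have h2 : ¬ (2 ≤ 3 * n ∧ 3 ∣ 3 * n - 2) := by omega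
    simp only [← ite_and, h1, h2]
    simp
  · have h1 : ¬ (3 ∣ 3 * n + 1) := by omega
    have h2 : ¬ (2 ≤ 3 * n + 1 ∧ 3 ∣ 3 * n + 1 - 2) := by omega
    simp only [← ite_and, h1, h2]
    simp
  · have h1 : ¬ (3 ∣ 3 * n + 2) := by omega
    have h2 : ¬ (1 ≤ 3 * n + 2 ∧ 3 ∣ 3 * n + 2 - 1) := by omega
    simp only [← ite_and, h1, h2]
    simp

theorem sec_tri_combination (a b c : PowerSeries ℤ) :
    sec 0 (tri a + X * tri b + X ^ 2 * tri c) = a ∧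
    sec 1 (tri a + X * tri b + X ^ 2 * tri c) = b ∧
    sec 2 (tri a + X * tri b + X ^ 2 * tri c) = c :=
  ⟨PowerSeries.ext fun n => (coeff_sec _ _ _).trans (coeff_tri_combination a b c n).1,
    PowerSeries.ext fun n => (coeff_sec _ _ _).trans (coeff_tri_combination a b c n).2.1,
    PowerSeries.ext fun n => (coeff_sec _ _ _).trans (coeff_tri_combination a b c n).2.2⟩

theorem eq_tri_combination (f : PowerSeries ℤ) :
    f = tri (sec 0 f) + X * tri (sec 1 f) + X ^ 2 * tri (sec 2 f) := by
  ext n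
  obtain ⟨h0, h1, h2⟩ := coeff_tri_combination (sec 0 f) (sec 1 f) (sec 2 f) (n / 3)
  rw [coeff_sec] at h0 h1 h2
  have h : n = 3 * (n / 3) ∨ n = 3 * (n / 3) + 1 ∨ n = 3 * (n / 3) + 2 := by omega
  generalize n / 3 = m at *
  rcases h with rfl | rfl | rfl
  · exact h0.symm
  · exact h1.symm
  · exact h2.symm

theorem sec_zero_tri_mul (g f : PowerSeries ℤ) : sec 0 (tri g * f) = g * sec 0 f := by
  have h : tri g * f = tri (g * sec 0 f) + X * tri (g * sec 1 f) + X ^ 2 * tri (g * sec 2 f) := by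
    conv_lhs => rw [eq_tri_combination f]
    simp only [map_mul]
    ring
  rw [h, (sec_tri_combination _ _ _).1]

theorem sec_zero_tri (g : PowerSeries ℤ) : sec 0 (tri g) = g := by
  simpa using (sec_tri_combination g 0 0).1

/-! ### The norm over the cube roots of unity -/

/-- The norm `∏_ω f(ω q)` over the cube roots of unity, as a series in `q^3`. -/
noncomputable def cubeNorm : PowerSeries ℤ →* PowerSeries ℤ where
  toFun f := sec 0 f ^ 3 + X * sec 1 f ^ 3 + X ^ 2 * sec 2 f ^ 3
    - 3 * X * (sec 0 f * sec 1 f * sec 2 f)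
  map_one' := by
    have h := sec_tri_combination 1 0 0
    simp only [map_one, map_zero, mul_zero, add_zero] at h
    rw [h.1, h.2.1, h.2.2]
    ring
  map_mul' f g := by
    have h : f * g = tri (sec 0 f * sec 0 g + X * (sec 1 f * sec 2 g + sec 2 f * sec 1 g))
        + X * tri (sec 0 f * sec 1 g + sec 1 f * sec 0 g + X * (sec 2 f * sec 2 g))
        + X ^ 2 * tri (sec 0 f * sec 2 g + sec 1 f * sec 1 g + sec 2 f * sec 0 g) := by
      conv_lhs => rw [eq_tri_combination f, eq_tri_combination g]
      simp only [map_mul, map_add, expand_X]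
      ring
    have h' := sec_tri_combination
      (sec 0 f * sec 0 g + X * (sec 1 f * sec 2 g + sec 2 f * sec 1 g))
      (sec 0 f * sec 1 g + sec 1 f * sec 0 g + X * (sec 2 f * sec 2 g))
      (sec 0 f * sec 2 g + sec 1 f * sec 1 g + sec 2 f * sec 0 g)
    rw [← h] at h'
    rw [h'.1, h'.2.1, h'.2.2]
    ring

theorem cubeNorm_tri_combination (a b c : PowerSeries ℤ) :
    cubeNorm (tri a + X * tri b + X ^ 2 * tri c)
      = a ^ 3 + X * b ^ 3 + X ^ 2 * c ^ 3 - 3 * X * (a * b * c) := by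
  obtain ⟨h0, h1, h2⟩ := sec_tri_combination a b c
  simp only [cubeNorm, MonoidHom.coe_mk, OneHom.coe_mk, h0, h1, h2]

theorem cubeNorm_one_sub_X_pow (m : ℕ) :
    cubeNorm (1 - X ^ (3 * m)) = (1 - X ^ m) ^ 3 ∧
    cubeNorm (1 - X ^ (3 * m + 1)) = 1 - X ^ (3 * m + 1) ∧
    cubeNorm (1 - X ^ (3 * m + 2)) = 1 - X ^ (3 * m + 2) := by
  have h0 := cubeNorm_tri_combination (1 - X ^ m) 0 0
  have h1 := cubeNorm_tri_combination 1 (-X ^ m) 0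
  have h2 := cubeNorm_tri_combination 1 0 (-X ^ m)
  simp only [map_sub, map_neg, map_one, map_zero, map_pow, expand_X, ← pow_mul] at h0 h1 h2
  refine ⟨?_, ?_, ?_⟩
  · convert h0 using 1
    · congr 1; ring
    · ring
  · convert h1 using 1
    · congr 1; ring
    · ring
  · convert h2 using 1
    · congr 1; ring
    · ring

theorem cubeNorm_qPoch (n : ℕ) : cubeNorm (qPoch X (3 * n)) * qPoch (X ^ 3) n
    = qPoch X (3 * n) * qPoch X n ^ 3 := by
  induction n with
  | zero => simp [qPoch]
  | succ n ih =>
    obtain ⟨-, h1, h2⟩ := cubeNorm_one_sub_X_pow n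
    obtain ⟨h3, -, -⟩ := cubeNorm_one_sub_X_pow (n + 1)
    have e : 3 * (n + 1) = 3 * n + 1 + 1 + 1 := by ring
    rw [e, qPoch_succ, qPoch_succ, qPoch_succ, qPoch_succ, qPoch_succ, map_mul, map_mul, map_mul,
      h1, h2, show 3 * n + 1 + 1 + 1 = 3 * (n + 1) by ring, h3, ← pow_mul]
    linear_combination ((1 - X ^ (3 * n + 1)) * (1 - X ^ (3 * n + 2)) * (1 - X ^ (3 * (n + 1)))
      * (1 - X ^ (n + 1)) ^ 3) * ih

section
open scoped PowerSeries.WithPiTopology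

theorem continuous_of_coeff {φ : PowerSeries ℤ → PowerSeries ℤ}
    (h : ∀ n, Continuous fun f => coeff n (φ f)) : Continuous φ :=
  continuous_iff_continuousAt.2 fun _ =>
    (WithPiTopology.tendsto_iff_coeff_tendsto _ _ _ _).2 fun n => (h n).continuousAt

theorem continuous_sec (i : ℕ) : Continuous (sec i) :=
  continuous_of_coeff fun n => by
    simp only [coeff_sec]
    exact WithPiTopology.continuous_coeff ℤ _

theorem continuous_expand {r : ℕ} (hr : r ≠ 0) :
    Continuous (expand r hr : PowerSeries ℤ → PowerSeries ℤ) :=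
  continuous_of_coeff fun n => by
    simp only [coeff_expand]
    split_ifs
    · exact WithPiTopology.continuous_coeff ℤ _
    · exact continuous_const

theorem continuous_cubeNorm : Continuous cubeNorm := by
  have h0 := continuous_sec 0
  have h1 := continuous_sec 1
  have h2 := continuous_sec 2
  change Continuous fun f => sec 0 f ^ 3 + X * sec 1 f ^ 3 + X ^ 2 * sec 2 f ^ 3
    - 3 * X * (sec 0 f * sec 1 f * sec 2 f)
  fun_prop

theorem tendsto_qPoch : Filter.Tendsto (qPoch (X : PowerSeries ℤ)) Filter.atTop
    (nhds (eulerE 1)) := by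
  have h := tendsto_prod_eulerE le_rfl
  simp only [one_mul] at h
  exact h

theorem expand_eulerE {r : ℕ} (hr : r ≠ 0) : expand r hr (eulerE 1) = eulerE r := by
  refine tendsto_nhds_unique (((continuous_expand hr).tendsto _).comp tendsto_qPoch) ?_
  convert tendsto_prod_eulerE (Nat.one_le_iff_ne_zero.2 hr) using 2 with n
  simp [qPoch, map_prod, pow_mul]

/-- `∏_ω E(ω q) = E(q^3)^4 / E(q^9)`. -/
theorem cubeNorm_eulerE : cubeNorm (eulerE 1) * tri (eulerE 1) = eulerE 1 ^ 4 := by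
  have h3 : Filter.Tendsto (fun n : ℕ => 3 * n) Filter.atTop Filter.atTop :=
    Filter.tendsto_id.const_mul_atTop' (by norm_num)
  have h := (((continuous_cubeNorm.tendsto _).comp (tendsto_qPoch.comp h3)).mul
    (((continuous_expand three_ne_zero).tendsto _).comp tendsto_qPoch))
  have h' := (tendsto_qPoch.comp h3).mul (tendsto_qPoch.pow 3)
  have e : eulerE 1 ^ 4 = eulerE 1 * eulerE 1 ^ 3 := by ring
  rw [e]
  refine tendsto_nhds_unique (h.congr fun n => ?_) h'
  have : tri (qPoch X n) = qPoch (X ^ 3) n := by simp [qPoch, map_prod]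
  simp only [Function.comp_apply]
  rw [this, cubeNorm_qPoch]

end

/-! ### The 3-dissection of E(q)^3 -/

/-- The triangular number T_k is 1 mod 3 exactly when k = 3l + 1, where T_k = 9T_l + 1 and
(-1)^k(2k+1) = -3(-1)^l(2l+1). -/
theorem sec_one_eulerE_cube : sec 1 (eulerE 1 ^ 3) = -3 * tri (eulerE 1 ^ 3) := by
  have key (l : ℕ) : (3 * l + 1 + 1).choose 2 = 9 * (l + 1).choose 2 + 1 := by
    induction l with
    | zero => rfl
    | succ l ih =>
      rw [show 3 * (l + 1) + 1 + 1 = 3 * l + 1 + 1 + 1 + 1 + 1 by ring, choose_two_succ,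
        choose_two_succ, choose_two_succ, ih, choose_two_succ (l + 1)]
      ring
  have e : (-3 : PowerSeries ℤ) = C (-3) := by simp
  ext n
  rw [coeff_sec, e, coeff_C_mul, coeff_expand]
  by_cases h : ∃ l : ℕ, n = 3 * (l + 1).choose 2
  · obtain ⟨l, rfl⟩ := h
    rw [if_pos (dvd_mul_right _ _), Nat.mul_div_cancel_left _ three_pos, coeff_choose_eulerE_cube,
      show 3 * (3 * (l + 1).choose 2) + 1 = (3 * l + 1 + 1).choose 2 by rw [key]; ring,
      coeff_choose_eulerE_cube, pow_succ, pow_mul]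
    push_cast
    ring
  · have h1 : coeff (3 * n + 1) (eulerE 1 ^ 3) = 0 := by
      by_contra hne
      obtain ⟨k, hk⟩ := exists_of_coeff_eulerE_cube_ne_zero hne
      have hk3 : k = 3 * (k / 3) ∨ k = 3 * (k / 3) + 1 ∨ k = 3 * (k / 3) + 2 := by omega
      generalize k / 3 = l at hk3
      have h9 := key l
      rcases hk3 with rfl | rfl | rfl
      · rw [choose_two_succ] at h9
        omega
      · exact h ⟨l, by omega⟩
      · rw [choose_two_succ, show 3 * l + 2 = 3 * l + 1 + 1 from rfl, h9] at hk
        omega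
    rw [h1]
    split_ifs with h3
    · obtain ⟨m, rfl⟩ := h3
      rw [Nat.mul_div_cancel_left _ three_pos]
      by_contra hne
      obtain ⟨k, hk⟩ := exists_of_coeff_eulerE_cube_ne_zero
        (fun h0 => hne (by rw [h0, mul_zero]))
      exact h ⟨k, by rw [hk]⟩
    · simp

theorem sec_two_eulerE_cube : sec 2 (eulerE 1 ^ 3) = 0 := by
  ext n
  rw [coeff_sec, map_zero]
  by_contra hne
  obtain ⟨k, hk⟩ := exists_of_coeff_eulerE_cube_ne_zero hne
  have h3 : ∀ k : ℕ, (k + 1).choose 2 % 3 ≠ 2 ∧ (k % 3 = 1 → (k + 1).choose 2 % 3 = 1) ∧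
      (k % 3 ≠ 1 → (k + 1).choose 2 % 3 = 0) := fun k => by
    induction k with
    | zero => decide
    | succ k ih => rw [choose_two_succ (k + 1)]; omega
  have := (h3 k).1
  omega

/-- The series `P` of the dissection `E(q)^3 = P(q^3) - 3 q E(q^9)^3`. -/
noncomputable def dissP : PowerSeries ℤ := sec 0 (eulerE 1 ^ 3)

theorem eulerE_cube_eq : eulerE 1 ^ 3 = tri dissP - 3 * X * tri (tri (eulerE 1 ^ 3)) := by
  conv_lhs => rw [eq_tri_combination (eulerE 1 ^ 3), sec_one_eulerE_cube, sec_two_eulerE_cube]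
  simp only [map_mul, map_neg, map_zero, map_ofNat, dissP]
  ring

/-- Take norms of both sides of the dissection of E(q)^3. -/
theorem dissP_cube : (dissP ^ 3 - 27 * X * tri (eulerE 1 ^ 9)) * tri (eulerE 1 ^ 3)
    = eulerE 1 ^ 12 := by
  have h := cubeNorm_tri_combination dissP (-3 * tri (eulerE 1 ^ 3)) 0
  have e : tri dissP + X * tri (-3 * tri (eulerE 1 ^ 3)) + X ^ 2 * tri 0 = eulerE 1 ^ 3 := by
    refine Eq.trans ?_ eulerE_cube_eq.symm
    simp only [map_mul, map_neg, map_zero, map_ofNat]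
    ring
  rw [e, map_pow] at h
  have h4 := cubeNorm_eulerE
  simp only [map_pow] at h ⊢
  calc _ = (cubeNorm (eulerE 1) * tri (eulerE 1)) ^ 3 := by rw [mul_pow, h]; ring
    _ = _ := by rw [h4]; ring

/-! ### Modular equations for x = `hauptX` and z = `hauptZ` -/

/-- The series `1 / E(q)`. -/
noncomputable def eulerInv : PowerSeries ℤ := invOfUnit (eulerE 1) 1

theorem eulerE_mul_eulerInv : eulerE 1 * eulerInv = 1 :=
  mul_invOfUnit _ _ (by simp [constantCoeff_eulerE le_rfl])

theorem tri_eulerE_mul_tri_eulerInv : tri (eulerE 1) * tri eulerInv = 1 := by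
  rw [← map_mul, eulerE_mul_eulerInv, map_one]

/-- The series `q E(q^9)^3 / E(q)^3`. -/
noncomputable def hauptX : PowerSeries ℤ := X * tri (tri (eulerE 1)) ^ 3 * eulerInv ^ 3

/-- The Hauptmodul `q E(q^3)^12 / E(q)^12`. -/
noncomputable def hauptZ : PowerSeries ℤ := X * tri (eulerE 1) ^ 12 * eulerInv ^ 12

theorem hauptX_mul : hauptX * eulerE 1 ^ 3 = X * tri (tri (eulerE 1)) ^ 3 := by
  have h := eulerE_mul_eulerInv
  calc _ = X * tri (tri (eulerE 1)) ^ 3 * (eulerE 1 * eulerInv) ^ 3 := by rw [hauptX]; ring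
    _ = _ := by rw [h]; ring

theorem hauptZ_mul : hauptZ * eulerE 1 ^ 12 = X * tri (eulerE 1) ^ 12 := by
  have h := eulerE_mul_eulerInv
  calc _ = X * tri (eulerE 1) ^ 12 * (eulerE 1 * eulerInv) ^ 12 := by rw [hauptZ]; ring
    _ = _ := by rw [h]; ring

theorem tri_hauptZ_mul :
    tri hauptZ * tri (eulerE 1) ^ 12 = X ^ 3 * tri (tri (eulerE 1)) ^ 12 := by
  have h := congrArg tri hauptZ_mul
  simpa only [map_mul, map_pow, expand_X] using h

theorem tri_dissP_cube :
    (tri dissP ^ 3 - 27 * (X * tri (tri (eulerE 1)) ^ 3) ^ 3) * tri (tri (eulerE 1)) ^ 3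
      = tri (eulerE 1) ^ 12 := by
  have h := congrArg tri dissP_cube
  simp only [map_mul, map_pow, map_sub, expand_X, map_ofNat] at h
  rw [← h]
  ring

theorem tri_dissP : tri dissP = eulerE 1 ^ 3 + 3 * (X * tri (tri (eulerE 1)) ^ 3) := by
  have h := eulerE_cube_eq
  simp only [map_pow] at h
  linear_combination -h

theorem eulerE_one_ne_zero : eulerE 1 ≠ 0 := isUnit_eulerE_one.ne_zero

theorem tri_eulerE_one_ne_zero : tri (eulerE 1) ≠ 0 :=
  (isUnit_eulerE_one.map tri).ne_zero

/-- This is `tri_dissP_cube` with P(q^3) eliminated through the dissection. It gives a three-term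
recursion for U(x^i). -/
theorem hauptX_cube : hauptX ^ 3 = tri hauptZ * (1 + 9 * hauptX + 27 * hauptX ^ 2) := by
  have hx := hauptX_mul
  have hz := tri_hauptZ_mul
  have hP := tri_dissP_cube
  rw [tri_dissP] at hP
  refine mul_right_cancel₀ (mul_ne_zero (pow_ne_zero 9 eulerE_one_ne_zero)
    (pow_ne_zero 12 tri_eulerE_one_ne_zero)) ?_
  generalize tri hauptZ = t at *
  generalize hauptX = x at *
  generalize eulerE 1 = e at *
  generalize tri (tri e) = e9 at *
  generalize tri e = e3 at *
  calc x ^ 3 * (e ^ 9 * e3 ^ 12) = (x * e ^ 3) ^ 3 * e3 ^ 12 := by ring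
    _ = X ^ 3 * e9 ^ 12 * (e ^ 9 + 9 * (x * e ^ 3) * e ^ 6 + 27 * (x * e ^ 3) ^ 2 * e ^ 3) := by
      rw [hx, ← hP]; ring
    _ = _ := by rw [← hz]; ring

theorem hauptX_pow_four : hauptX ^ 4 = tri hauptZ * hauptZ := by
  have hx := hauptX_mul
  have hz := tri_hauptZ_mul
  have hz' := hauptZ_mul
  refine mul_right_cancel₀ (mul_ne_zero (pow_ne_zero 12 eulerE_one_ne_zero)
    (pow_ne_zero 12 tri_eulerE_one_ne_zero)) ?_
  calc _ = (hauptX * eulerE 1 ^ 3) ^ 4 * tri (eulerE 1) ^ 12 := by ring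
    _ = (tri hauptZ * tri (eulerE 1) ^ 12) * (hauptZ * eulerE 1 ^ 12) := by
      rw [hx, hz, hz']; ring
    _ = _ := by ring

theorem tri_hauptZ_ne_zero : tri hauptZ ≠ 0 := by
  intro h
  have := tri_hauptZ_mul
  rw [h, zero_mul, eq_comm] at this
  exact mul_ne_zero (pow_ne_zero 3 X_ne_zero)
    (pow_ne_zero 12 ((isUnit_eulerE_one.map tri).map tri).ne_zero) this

theorem hauptZ_eq : hauptZ = hauptX + 9 * hauptX ^ 2 + 27 * hauptX ^ 3 := by
  refine mul_left_cancel₀ tri_hauptZ_ne_zero ?_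
  rw [← hauptX_pow_four]
  linear_combination hauptX * hauptX_cube

/-! ### The action of U on x and x^2 -/

/-- With y = qE(q^9)^3, the denominator E^3 = P(q^3) - 3y is rationalized by P^2 + 3yP + 9y^2. The
powers of y then display the 3-dissection. -/
theorem hauptX_mul_tri : tri (eulerE 1 ^ 12) * hauptX
    = (X * tri (tri (eulerE 1)) ^ 3) * (tri dissP ^ 2
      + 3 * (X * tri (tri (eulerE 1)) ^ 3) * tri dissP
      + 9 * (X * tri (tri (eulerE 1)) ^ 3) ^ 2) * tri (tri (eulerE 1)) ^ 3 := by
  refine mul_right_cancel₀ (pow_ne_zero 3 eulerE_one_ne_zero) ?_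
  have hx := hauptX_mul
  have hP := tri_dissP_cube
  have hE : eulerE 1 ^ 3 = tri dissP - 3 * (X * tri (tri (eulerE 1)) ^ 3) := by
    rw [tri_dissP]; ring
  rw [map_pow, mul_assoc, hx, hE, ← hP]
  ring

theorem sec_zero_hauptX : sec 0 hauptX = 9 * hauptZ := by
  refine mul_left_cancel₀ (pow_ne_zero 12 eulerE_one_ne_zero) ?_
  rw [← sec_zero_tri_mul]
  have h : tri (eulerE 1 ^ 12) * hauptX = tri (9 * X * tri (eulerE 1) ^ 12)
      + X * tri (dissP ^ 2 * tri (eulerE 1) ^ 6)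
      + X ^ 2 * tri (3 * dissP * tri (eulerE 1) ^ 9) := by
    rw [hauptX_mul_tri]
    simp only [map_mul, map_pow, map_ofNat, expand_X]
    ring
  rw [h, (sec_tri_combination _ _ _).1]
  linear_combination (-9) * hauptZ_mul

theorem sec_zero_hauptX_sq : sec 0 (hauptX ^ 2) = 6 * hauptZ + 243 * hauptZ ^ 2 := by
  refine mul_left_cancel₀ (pow_ne_zero 24 eulerE_one_ne_zero) ?_
  rw [← sec_zero_tri_mul]
  have h : tri (eulerE 1 ^ 24) * hauptX ^ 2
      = tri (6 * X * tri (eulerE 1) ^ 15 * dissP ^ 3 + 81 * X ^ 2 * tri (eulerE 1) ^ 24)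
      + X * tri (27 * X * tri (eulerE 1) ^ 18 * dissP ^ 2)
      + X ^ 2 * tri (tri (eulerE 1) ^ 12 * dissP ^ 4
        + 54 * X * dissP * tri (eulerE 1) ^ 21) := by
    have e : tri (eulerE 1 ^ 24) * hauptX ^ 2 = (tri (eulerE 1 ^ 12) * hauptX) ^ 2 := by
      simp only [map_pow]; ring
    rw [e, hauptX_mul_tri]
    simp only [map_mul, map_pow, map_ofNat, map_add, expand_X]
    ring
  rw [h, (sec_tri_combination _ _ _).1]
  have hP := dissP_cube
  simp only [map_pow] at hP
  calc _ = 6 * (X * tri (eulerE 1) ^ 12) * ((dissP ^ 3 - 27 * X * tri (eulerE 1) ^ 9)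
        * tri (eulerE 1) ^ 3) + 243 * (X * tri (eulerE 1) ^ 12) ^ 2 := by ring
    _ = _ := by rw [hP, ← hauptZ_mul]; ring

open Polynomial in
-- 3-adic gain on polynomials in z
/-- `f` is a polynomial in `t` with integer coefficients and without constant term. -/
def IsPolyIn (t f : PowerSeries ℤ) : Prop := ∃ p : ℤ[X], f = t * aeval t p

namespace IsPolyIn
variable {t f g : PowerSeries ℤ}

theorem self (t : PowerSeries ℤ) : IsPolyIn t t := ⟨1, by simp⟩

theorem add : IsPolyIn t f → IsPolyIn t g → IsPolyIn t (f + g)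
  | ⟨p, hp⟩, ⟨q, hq⟩ => ⟨p + q, by rw [hp, hq, map_add, mul_add]⟩

theorem zsmul (a : ℤ) : IsPolyIn t f → IsPolyIn t (a • f)
  | ⟨p, hp⟩ => ⟨a • p, by rw [hp, map_zsmul, mul_smul_comm]⟩

theorem self_mul : IsPolyIn t f → IsPolyIn t (t * f)
  | ⟨p, hp⟩ => ⟨Polynomial.X * p, by rw [hp, map_mul, Polynomial.aeval_X]⟩

theorem exists_of_three_mul : IsPolyIn (3 * t) f → ∃ g, IsPolyIn t g ∧ f = 3 * g
  | ⟨p, hp⟩ => ⟨_, ⟨p.comp (3 * Polynomial.X), rfl⟩, by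
      rw [hp, Polynomial.aeval_comp]; simp [mul_assoc, map_ofNat]⟩

end IsPolyIn

/-- For X = 3x and Z = 27z everything is integral: U(X) = Z, U(X^2) = 2Z + 3Z^2 and X^3 = Z(q^3)(1 +
3X + 3X^2), which drives the recursion. -/
theorem isPolyIn_sec_zero_pow : ∀ i : ℕ,
    IsPolyIn (27 * hauptZ) (sec 0 ((3 * hauptX) ^ (i + 1)))
  | 0 => by
    have h : (3 * hauptX) ^ (0 + 1) = (3 : ℤ) • hauptX := by simp
    rw [h, map_zsmul, sec_zero_hauptX]
    convert IsPolyIn.self (27 * hauptZ) using 1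
    simp only [zsmul_eq_mul]
    push_cast
    ring
  | 1 => by
    have h : (3 * hauptX) ^ (1 + 1) = (9 : ℤ) • hauptX ^ 2 := by
      simp only [zsmul_eq_mul]; push_cast; ring
    rw [h, map_zsmul, sec_zero_hauptX_sq]
    convert ((IsPolyIn.self (27 * hauptZ)).zsmul 2).add
      ((IsPolyIn.self (27 * hauptZ)).self_mul.zsmul 3) using 1
    simp only [zsmul_eq_mul]
    push_cast
    ring
  | 2 => by
    have h : (3 * hauptX) ^ (2 + 1) = tri (27 * hauptZ) * (1 + (3 : ℤ) • (3 * hauptX) ^ (0 + 1)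
        + (3 : ℤ) • (3 * hauptX) ^ (1 + 1)) := by
      simp only [zsmul_eq_mul, map_mul, map_ofNat]
      push_cast
      linear_combination 27 * hauptX_cube
    have h1 : sec 0 1 = 1 := by simpa using sec_zero_tri 1
    rw [h, sec_zero_tri_mul, map_add, map_add, map_zsmul, map_zsmul, mul_add, mul_add, h1, mul_one]
    exact ((IsPolyIn.self _).add ((isPolyIn_sec_zero_pow 0).zsmul 3).self_mul).add
      ((isPolyIn_sec_zero_pow 1).zsmul 3).self_mul
  | i + 3 => by
    have h : (3 * hauptX) ^ (i + 3 + 1) = tri (27 * hauptZ) * ((3 * hauptX) ^ (i + 1)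
        + (3 : ℤ) • (3 * hauptX) ^ (i + 1 + 1) + (3 : ℤ) • (3 * hauptX) ^ (i + 2 + 1)) := by
      simp only [zsmul_eq_mul, map_mul, map_ofNat]
      push_cast
      linear_combination 27 * (3 * hauptX) ^ (i + 1) * hauptX_cube
    rw [h, sec_zero_tri_mul, map_add, map_add, map_zsmul, map_zsmul]
    exact (((isPolyIn_sec_zero_pow i).add ((isPolyIn_sec_zero_pow (i + 1)).zsmul 3)).add
      ((isPolyIn_sec_zero_pow (i + 2)).zsmul 3)).self_mul

theorem isPolyIn_sec_zero {f : PowerSeries ℤ} (hf : IsPolyIn (3 * hauptX) f) :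
    IsPolyIn (27 * hauptZ) (sec 0 f) := by
  obtain ⟨p, rfl⟩ := hf
  induction p using Polynomial.induction_on' with
  | add p q hp hq =>
    rw [map_add, mul_add, map_add]
    exact hp.add hq
  | monomial n a =>
    have : 3 * hauptX * Polynomial.aeval (3 * hauptX) (Polynomial.monomial n a)
        = a • (3 * hauptX) ^ (n + 1) := by
      rw [Polynomial.aeval_monomial, pow_succ, zsmul_eq_mul, eq_intCast]
      ring
    rw [this, map_zsmul]
    exact (isPolyIn_sec_zero_pow n).zsmul a

theorem exists_sec_zero_eq {f : PowerSeries ℤ} (hf : IsPolyIn (3 * hauptX) f) :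
    ∃ g, IsPolyIn (9 * hauptZ) g ∧ sec 0 f = 3 * g := by
  refine IsPolyIn.exists_of_three_mul ?_
  convert isPolyIn_sec_zero hf using 1
  ring

theorem nine_mul_hauptZ_eq :
    9 * hauptZ = Polynomial.aeval (3 * hauptX)
      (3 * Polynomial.X * (1 + 3 * Polynomial.X + 3 * Polynomial.X ^ 2) : Polynomial ℤ) := by
  rw [hauptZ_eq]
  simp [map_ofNat]
  ring

/-- One factor 3 comes from 9z = 3·(3x)(1 + 9x + 27x^2), the other from 27z = 3·9z after applying U.
-/
theorem IsPolyIn.exists_sec_zero {f : PowerSeries ℤ} (hf : IsPolyIn (9 * hauptZ) f) :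
    ∃ g, IsPolyIn (9 * hauptZ) g ∧ sec 0 f = 9 * g := by
  obtain ⟨p, rfl⟩ := hf
  obtain ⟨g, hg, h⟩ := exists_sec_zero_eq ⟨(1 + 3 * Polynomial.X + 3 * Polynomial.X ^ 2)
    * p.comp (3 * Polynomial.X * (1 + 3 * Polynomial.X + 3 * Polynomial.X ^ 2)), rfl⟩
  refine ⟨g, hg, ?_⟩
  rw [map_mul (Polynomial.aeval (3 * hauptX)), Polynomial.aeval_comp, ← nine_mul_hauptZ_eq] at h
  have e : 9 * hauptZ * Polynomial.aeval (9 * hauptZ) p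
      = (3 : ℤ) • (3 * hauptX * (Polynomial.aeval (3 * hauptX)
        (1 + 3 * Polynomial.X + 3 * Polynomial.X ^ 2 : Polynomial ℤ)
        * Polynomial.aeval (9 * hauptZ) p)) := by
    nth_rewrite 1 [nine_mul_hauptZ_eq]
    simp [map_ofNat]
    ring
  rw [e, map_zsmul, h]
  simp only [zsmul_eq_mul]
  push_cast
  ring

/-- Here the 3 in 9z = 3·(3x)(…) is spent on turning x into 3x, so only the gain from U remains. -/
theorem IsPolyIn.exists_sec_zero_hauptX_mul {f : PowerSeries ℤ} (hf : IsPolyIn (9 * hauptZ) f) :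
    ∃ g, IsPolyIn (9 * hauptZ) g ∧ sec 0 (hauptX * f) = 3 * g := by
  obtain ⟨p, rfl⟩ := hf
  refine exists_sec_zero_eq ⟨Polynomial.X * (1 + 3 * Polynomial.X + 3 * Polynomial.X ^ 2)
    * p.comp (3 * Polynomial.X * (1 + 3 * Polynomial.X + 3 * Polynomial.X ^ 2)), ?_⟩
  rw [map_mul _ _ (p.comp _), Polynomial.aeval_comp, ← nine_mul_hauptZ_eq]
  nth_rewrite 1 [nine_mul_hauptZ_eq]
  simp [map_ofNat]
  ring

/-! ### Iterating along the progressions -/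

theorem twoColorTriples_eq_coeff {l : ℕ} (hl : l ≠ 0) (n : ℕ) :
    twoColorTriples l n = coeff n (eulerInv ^ 3 * expand l hl (eulerInv ^ 3)) := by
  have h1 := twoColorTriples_spec (Nat.one_le_iff_ne_zero.2 hl)
  have h2 : expand l hl (eulerE 1) * expand l hl eulerInv = 1 := by
    rw [← map_mul, eulerE_mul_eulerInv, map_one]
  have h3 := eulerE_mul_eulerInv
  rw [← expand_eulerE hl] at h1
  have : mk (twoColorTriples l) = eulerInv ^ 3 * expand l hl (eulerInv ^ 3) := by
    rw [map_pow]
    calc _ = mk (twoColorTriples l) * ((eulerE 1 * eulerInv) ^ 3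
          * (expand l hl (eulerE 1) * expand l hl eulerInv) ^ 3) := by rw [h2, h3]; ring
      _ = (mk (twoColorTriples l) * (eulerE 1 ^ 3 * expand l hl (eulerE 1) ^ 3))
          * (eulerInv ^ 3 * expand l hl eulerInv ^ 3) := by ring
      _ = _ := by rw [h1, one_mul]
  rw [← this, coeff_mk]

theorem X_mul_eulerInv_cube : X * eulerInv ^ 3 = tri (tri eulerInv) ^ 3 * hauptX := by
  have h : tri (tri (eulerE 1)) * tri (tri eulerInv) = 1 := by
    rw [← map_mul, tri_eulerE_mul_tri_eulerInv, map_one]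
  calc _ = X * eulerInv ^ 3 * (tri (tri (eulerE 1)) * tri (tri eulerInv)) ^ 3 := by rw [h]; ring
    _ = _ := by rw [hauptX]; ring

/-- Multiplying by q moves the index to 3(n + 1), where U applies, and turns 1/E^3 into x/E(q^9)^3.
-/
theorem coeff_eulerInv_cube_mul (n : ℕ) (f g : PowerSeries ℤ) :
    coeff (3 * n + 2) (eulerInv ^ 3 * tri g * f)
      = coeff (n + 1) (tri eulerInv ^ 3 * g * sec 0 (hauptX * f)) := by
  have h : X * (eulerInv ^ 3 * tri g * f) = tri (tri eulerInv ^ 3 * g) * (hauptX * f) := by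
    rw [map_mul, map_pow]
    linear_combination (tri g * f) * X_mul_eulerInv_cube
  rw [← sec_zero_tri_mul, ← h, coeff_sec, show 3 * (n + 1) + 0 = (3 * n + 2) + 1 by ring,
    coeff_succ_X_mul]

/-- The series `M` with `∑ p(3^(2a+1) n + c) q^(n+1) = M / E(q^3)^3` for the coefficients `p` of
`1 / E(q)^3`. -/
noncomputable def oddLevel : ℕ → PowerSeries ℤ
  | 0 => 9 * hauptZ
  | a + 1 => sec 0 (hauptX * sec 0 (oddLevel a))

theorem exists_oddLevel_eq (a : ℕ) :
    ∃ w, IsPolyIn (9 * hauptZ) w ∧ oddLevel a = (3 ^ (3 * a) : ℤ) • w := by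
  induction a with
  | zero => exact ⟨_, IsPolyIn.self _, by simp [oddLevel]⟩
  | succ a ih =>
    obtain ⟨w, hw, h⟩ := ih
    obtain ⟨u, hu, h1⟩ := hw.exists_sec_zero
    obtain ⟨v, hv, h2⟩ := hu.exists_sec_zero_hauptX_mul
    refine ⟨v, hv, ?_⟩
    have e : hauptX * ((3 ^ (3 * a) : ℤ) • (9 * u)) = (3 ^ (3 * a) * 9 : ℤ) • (hauptX * u) := by
      simp only [zsmul_eq_mul]; push_cast; ring
    rw [oddLevel, h, map_zsmul, h1, e, map_zsmul, h2]
    simp only [zsmul_eq_mul]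
    push_cast
    ring

theorem expand_mul_nine {m m' : ℕ} (hm : m ≠ 0) (hm' : m' ≠ 0) (h : m' = m * 3 * 3)
    (g : PowerSeries ℤ) : expand m' hm' g = expand m hm (tri (tri g)) := by
  subst h
  rw [expand_mul (m * 3) (by positivity) 3 three_ne_zero, expand_mul m hm 3 three_ne_zero]

theorem coeff_eulerInv_cube_mul_expand (a : ℕ) : ∀ (n c : ℕ) (g : PowerSeries ℤ),
    8 * c = 5 * 3 ^ (2 * a + 1) + 1 →
    coeff (3 ^ (2 * a + 1) * n + c) (eulerInv ^ 3 * expand (3 ^ (2 * a + 1)) (by positivity) g)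
      = coeff (n + 1) (tri eulerInv ^ 3 * g * oddLevel a) := by
  induction a with
  | zero =>
    intro n c g hc
    obtain rfl : c = 2 := by norm_num at hc; omega
    have h := coeff_eulerInv_cube_mul n 1 g
    rw [mul_one, mul_one, sec_zero_hauptX] at h
    simpa [oddLevel] using h
  | succ a ih =>
    intro n c g hc
    have e : 3 ^ (2 * (a + 1) + 1) = 3 ^ (2 * a + 1) * 3 * 3 := by ring
    rw [e] at hc
    -- The previous level is read at 9n + 5, hence at coefficient 9n + 6 = 3(3n + 2): U applies,
    -- followed by U(x·).
    obtain ⟨c', rfl⟩ : ∃ c', c = 3 ^ (2 * a + 1) * 5 + c' :=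
      ⟨c - 3 ^ (2 * a + 1) * 5, by omega⟩
    rw [expand_mul_nine (by positivity) (by positivity) e,
      show 3 ^ (2 * (a + 1) + 1) * n + (3 ^ (2 * a + 1) * 5 + c')
        = 3 ^ (2 * a + 1) * (9 * n + 5) + c' by rw [e]; ring, ih _ _ _ (by omega), oddLevel,
      ← coeff_eulerInv_cube_mul, ← sec_zero_tri_mul, coeff_sec, map_mul tri, map_pow tri,
      show 3 * (3 * n + 2) + 0 = 9 * n + 5 + 1 by ring]

/-- The prefactor 1/(E^3 E(q^3)^3) reproduces itself under extraction of the indices 3n + 2, so the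
step can be repeated. -/
theorem coeff_iterate_sec (b : ℕ) : ∀ (n d : ℕ) (f : PowerSeries ℤ), 2 * d + 1 = 3 ^ b →
    coeff (3 ^ b * n + d + 1) (tri eulerInv ^ 3 * eulerInv ^ 3 * f)
      = coeff (n + 1) (tri eulerInv ^ 3 * eulerInv ^ 3
        * (fun f => sec 0 (hauptX * f))^[b] f) := by
  induction b with
  | zero =>
    intro n d f hd
    obtain rfl : d = 0 := by simpa using hd
    simp
  | succ b ih =>
    intro n d f hd
    rw [pow_succ] at hd
    obtain ⟨d', rfl⟩ : ∃ d', d = 3 * d' + 1 := ⟨(d - 1) / 3, by omega⟩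
    rw [Function.iterate_succ_apply, ← ih n d' _ (by omega), ← coeff_eulerInv_cube_mul, map_pow]
    congr 2
    · ring
    · ring

theorem exists_iterate_eq (b : ℕ) {w : PowerSeries ℤ} (hw : IsPolyIn (9 * hauptZ) w) (k : ℤ) :
    ∃ v, IsPolyIn (9 * hauptZ) v ∧
      (fun f => sec 0 (hauptX * f))^[b] (k • w) = (k * 3 ^ b) • v := by
  induction b generalizing w k with
  | zero => exact ⟨w, hw, by simp⟩
  | succ b ih =>
    obtain ⟨u, hu, h⟩ := hw.exists_sec_zero_hauptX_mul
    obtain ⟨v, hv, h'⟩ := ih hu (k * 3)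
    refine ⟨v, hv, ?_⟩
    have e : sec 0 (hauptX * k • w) = (k * 3) • u := by
      rw [mul_smul_comm, map_zsmul, h]
      simp only [zsmul_eq_mul]
      push_cast
      ring
    rw [Function.iterate_succ_apply, e, h', pow_succ]
    congr 1
    ring

theorem twoColorTriples_eq (a b n c : ℕ)
    (hc : 8 * c = 4 * 3 ^ (2 * a + b + 1) + 3 ^ (2 * a + 1) + 1) :
    ∃ w, IsPolyIn (9 * hauptZ) w ∧
      twoColorTriples (3 ^ (2 * a + 1)) (3 ^ (2 * a + b + 1) * n + c)
        = 3 ^ (3 * a + b) * coeff (n + 1) (tri eulerInv ^ 3 * eulerInv ^ 3 * w) := by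
  obtain ⟨w, hw, h⟩ := exists_oddLevel_eq a
  obtain ⟨v, hv, h'⟩ := exists_iterate_eq b hw (3 ^ (3 * a))
  refine ⟨v, hv, ?_⟩
  obtain ⟨d, hd⟩ : Odd (3 ^ b) := Odd.pow (by decide)
  have e : 3 ^ (2 * a + b + 1) = 3 ^ (2 * a + 1) * (2 * d + 1) := by rw [← hd]; ring
  have e' : 3 ^ (2 * a + 1) * (2 * d + 1) = 2 * (3 ^ (2 * a + 1) * d) + 3 ^ (2 * a + 1) := by ring
  obtain ⟨c', rfl, hc'⟩ : ∃ c', c = 3 ^ (2 * a + 1) * d + c' ∧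
      8 * c' = 5 * 3 ^ (2 * a + 1) + 1 := by
    rw [e, e'] at hc
    generalize 3 ^ (2 * a + 1) = s at hc ⊢
    generalize s * d = t at hc ⊢
    exact ⟨c - t, by omega, by omega⟩
  have hi : 3 ^ (2 * a + b + 1) * n + (3 ^ (2 * a + 1) * d + c')
      = 3 ^ (2 * a + 1) * (3 ^ b * n + d) + c' := by ring
  rw [hi, twoColorTriples_eq_coeff (by positivity),
    coeff_eulerInv_cube_mul_expand a _ c' _ hc', h, coeff_iterate_sec b n d _ hd.symm, h',
    mul_smul_comm, map_zsmul, smul_eq_mul, pow_add]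

/-! ### Reduction modulo 9 -/

/-- Modulo 9, the coefficient at n > 0 is 0 or equals the one at n/3, so descent kills it. -/
theorem exists_eq_one_add_of_tri {f k : PowerSeries ℤ} (h : tri f = f + 9 * k)
    (h1 : constantCoeff f = 1) : ∃ k', f = 1 + 9 * k' := by
  have e : (9 : PowerSeries ℤ) = C 9 := by simp
  rw [e] at h ⊢
  have key : ∀ n, (9 : ℤ) ∣ coeff n (f - 1) := by
    intro n
    induction n using Nat.strong_induction_on with
    | _ n ih =>
      rcases Nat.eq_zero_or_pos n with rfl | hn
      · simp [h1]
      · have hc := congrArg (coeff n) h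
        rw [coeff_expand, map_add, coeff_C_mul] at hc
        have h0 : ∀ m, 0 < m → coeff m (f - 1) = coeff m f := fun m hm => by
          rw [map_sub, coeff_one, if_neg hm.ne', sub_zero]
        rw [h0 n hn]
        split_ifs at hc with h3
        · have := ih (n / 3) (Nat.div_lt_self hn (by norm_num))
          rw [h0 _ (Nat.div_pos (Nat.le_of_dvd hn h3) three_pos), hc] at this
          exact (dvd_add_left (dvd_mul_right _ _)).1 this
        · exact ⟨-coeff n k, by linarith⟩
  choose k' hk' using key
  refine ⟨mk k', ?_⟩
  ext n
  have := hk' n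
  rw [map_sub] at this
  rw [map_add, coeff_C_mul, coeff_mk]
  linarith

/-- The quotient f = E^9/E(q^3)^3 satisfies f(q^3) ≡ f mod 9, by expanding the cube in
`tri_dissP_cube`. -/
theorem exists_eulerE_pow_nine_eq : ∃ k, eulerE 1 ^ 9 = tri (eulerE 1) ^ 3 * (1 + 9 * k) := by
  have hP := tri_dissP_cube
  have h3 := tri_eulerE_mul_tri_eulerInv
  have h9 : tri (tri (eulerE 1)) * tri (tri eulerInv) = 1 := by
    rw [← map_mul, tri_eulerE_mul_tri_eulerInv, map_one]
  have hc : constantCoeff (eulerE 1 ^ 9 * tri eulerInv ^ 3) = 1 := by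
    have := congrArg constantCoeff h3
    simp only [map_mul, constantCoeff_expand, constantCoeff_eulerE le_rfl, map_one, one_mul] at this
    simp [constantCoeff_eulerE le_rfl, this]
  have ht : tri (eulerE 1 ^ 9 * tri eulerInv ^ 3)
      = eulerE 1 ^ 9 * tri eulerInv ^ 3 + 9 * (((X * tri (tri (eulerE 1)) ^ 3) * eulerE 1 ^ 6
        + 3 * (X * tri (tri (eulerE 1)) ^ 3) ^ 2 * eulerE 1 ^ 3) * tri eulerInv ^ 3) := by
    rw [tri_dissP] at hP
    simp only [map_mul, map_pow]
    calc _ = tri (eulerE 1) ^ 9 * tri (tri eulerInv) ^ 3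
          * (tri (eulerE 1) * tri eulerInv) ^ 3 := by rw [h3]; ring
      _ = tri (eulerE 1) ^ 12 * tri (tri eulerInv) ^ 3 * tri eulerInv ^ 3 := by ring
      _ = ((eulerE 1 ^ 3 + 3 * (X * tri (tri (eulerE 1)) ^ 3)) ^ 3
          - 27 * (X * tri (tri (eulerE 1)) ^ 3) ^ 3) * tri eulerInv ^ 3
          * (tri (tri (eulerE 1)) * tri (tri eulerInv)) ^ 3 := by rw [← hP]; ring
      _ = _ := by rw [h9]; ring
  obtain ⟨k, hk⟩ := exists_eq_one_add_of_tri ht hc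
  refine ⟨k, ?_⟩
  rw [← hk]
  calc _ = eulerE 1 ^ 9 * (tri (eulerE 1) * tri eulerInv) ^ 3 := by rw [h3]; ring
    _ = _ := by ring

theorem exists_eulerInv_mul_hauptZ_eq : ∃ k, tri eulerInv ^ 3 * eulerInv ^ 3 * hauptZ
    = X * (eulerE 1 ^ 3 * tri (eulerE 1 ^ 3) + 9 * k) := by
  obtain ⟨k, hk⟩ := exists_eulerE_pow_nine_eq
  have h1 := eulerE_mul_eulerInv
  have h3 := tri_eulerE_mul_tri_eulerInv
  refine ⟨-(tri (eulerE 1) ^ 9 * eulerInv ^ 15 * (2 * k + 9 * k ^ 2)), ?_⟩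
  have e : tri eulerInv ^ 3 * eulerInv ^ 3 * hauptZ = X * (tri (eulerE 1) ^ 9 * eulerInv ^ 15) := by
    calc _ = X * (tri (eulerE 1) ^ 9 * eulerInv ^ 15)
          * (tri (eulerE 1) * tri eulerInv) ^ 3 := by rw [hauptZ]; ring
      _ = _ := by rw [h3]; ring
  have e2 : eulerE 1 ^ 3 * tri (eulerE 1) ^ 3
      = tri (eulerE 1) ^ 9 * eulerInv ^ 15 * (1 + 9 * k) ^ 2 := by
    calc _ = eulerE 1 ^ 3 * tri (eulerE 1) ^ 3 * (eulerE 1 * eulerInv) ^ 15 := by rw [h1]; ring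
      _ = (eulerE 1 ^ 9) ^ 2 * tri (eulerE 1) ^ 3 * eulerInv ^ 15 := by ring
      _ = _ := by rw [hk]; ring
  rw [e, map_pow, e2]
  ring

/-- Terms of degree at least 2 in 9z vanish mod 81; the linear one is reduced mod 9 after taking out
its 9. -/
theorem IsPolyIn.exists_coeff_eq {w : PowerSeries ℤ} (hw : IsPolyIn (9 * hauptZ) w) (n : ℕ) :
    ∃ c d : ℤ, coeff (n + 1) (tri eulerInv ^ 3 * eulerInv ^ 3 * w)
      = 9 * (c * coeff n (eulerE 1 ^ 3 * tri (eulerE 1 ^ 3))) + 81 * d := by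
  obtain ⟨p, rfl⟩ := hw
  obtain ⟨k, hk⟩ := exists_eulerInv_mul_hauptZ_eq
  rw [← Polynomial.divX_mul_X_add p]
  generalize p.divX = r
  generalize p.coeff 0 = c
  refine ⟨c, c * coeff n k + coeff (n + 1) (tri eulerInv ^ 3 * eulerInv ^ 3 * hauptZ ^ 2
    * Polynomial.aeval (9 * hauptZ) r), ?_⟩
  have e : tri eulerInv ^ 3 * eulerInv ^ 3 * (9 * hauptZ
      * Polynomial.aeval (9 * hauptZ) (r * Polynomial.X + Polynomial.C c))
      = (9 * c) • (X * (eulerE 1 ^ 3 * tri (eulerE 1 ^ 3))) + (81 * c) • (X * k)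
        + (81 : ℤ) • (tri eulerInv ^ 3 * eulerInv ^ 3 * hauptZ ^ 2
          * Polynomial.aeval (9 * hauptZ) r) := by
    simp only [map_add, map_mul (Polynomial.aeval _), Polynomial.aeval_X, Polynomial.aeval_C,
      zsmul_eq_mul]
    rw [eq_intCast (algebraMap ℤ (PowerSeries ℤ))]
    push_cast
    linear_combination 9 * (c : PowerSeries ℤ) * hk
  rw [e]
  simp only [map_add, map_zsmul, coeff_succ_X_mul, smul_eq_mul]
  ring

/-! ### The form x^2 + 3y^2 and the theorem -/

/-- A nonzero coefficient forces n = T_k + 3T_l; complete squares with 8T_k + 1 = (2k+1)^2. -/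
theorem exists_sq_add_three_mul_sq {n : ℕ}
    (h : coeff n (eulerE 1 ^ 3 * tri (eulerE 1 ^ 3)) ≠ 0) :
    ∃ x y : ℤ, 4 * (2 * (n : ℤ) + 1) = x ^ 2 + 3 * y ^ 2 := by
  rw [coeff_mul] at h
  obtain ⟨⟨i, j⟩, hij, hne⟩ := Finset.exists_ne_zero_of_sum_ne_zero h
  rw [Finset.HasAntidiagonal.mem_antidiagonal] at hij
  obtain ⟨k, hk⟩ := exists_of_coeff_eulerE_cube_ne_zero (left_ne_zero_of_mul hne)
  have hj := right_ne_zero_of_mul hne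
  simp only [coeff_expand] at hj hk hij
  split_ifs at hj with h3
  · obtain ⟨m, rfl⟩ := h3
    rw [Nat.mul_div_cancel_left _ three_pos] at hj
    obtain ⟨l, hl⟩ := exists_of_coeff_eulerE_cube_ne_zero hj
    have key : ∀ k : ℕ, 2 * (((k + 1).choose 2 : ℕ) : ℤ) = k * (k + 1) := fun k => by
      induction k with
      | zero => simp
      | succ k ih =>
        rw [choose_two_succ (k + 1)]
        push_cast
        linarith
    refine ⟨2 * k + 1, 2 * l + 1, ?_⟩
    have h1 := key k
    have h2 := key l
    rw [← hk] at h1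
    rw [← hl] at h2
    have : (n : ℤ) = i + 3 * m := by exact_mod_cast hij.symm
    rw [this]
    linarith
  · exact absurd rfl hj

/-- As -3 is a nonresidue, p dividing x^2 + 3y^2 divides x and y; descent by p^2 ends at exponent 1.
-/
theorem sq_add_three_mul_sq_ne {p : ℕ} [Fact p.Prime] (hp : legendreSym p (-3) = -1)
    {m : ℤ} (hm : ¬ (p : ℤ) ∣ m) (k : ℕ) (x y : ℤ) :
    p ^ (2 * k + 1) * m ≠ x ^ 2 + 3 * y ^ 2 := by
  have hp0 : (p : ℤ) ≠ 0 := by exact_mod_cast (Fact.out : p.Prime).ne_zero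
  induction k generalizing x y with
  | zero =>
    intro h
    have hd : (p : ℤ) ∣ x ^ 2 - (-3) * y ^ 2 := ⟨m, by linear_combination -h⟩
    obtain ⟨⟨u, rfl⟩, ⟨v, rfl⟩⟩ := legendreSym.prime_dvd_of_eq_neg_one hp hd
    refine hm ⟨u ^ 2 + 3 * v ^ 2, mul_left_cancel₀ hp0 ?_⟩
    linear_combination h
  | succ k ih =>
    intro h
    have hd : (p : ℤ) ∣ x ^ 2 - (-3) * y ^ 2 :=
      ⟨p ^ (2 * k + 2) * m, by linear_combination -h⟩
    obtain ⟨⟨u, rfl⟩, ⟨v, rfl⟩⟩ := legendreSym.prime_dvd_of_eq_neg_one hp hd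
    refine ih u v (mul_left_cancel₀ (pow_ne_zero 2 hp0) ?_)
    linear_combination h

theorem theorem1p5 (n α β : ℕ) :
    twoColorTriples (3 ^ (2 * α + 1))
        (3 ^ (2 * α + β + 1) * n
          + (4 * 3 ^ (2 * α + β + 1) + 3 ^ (2 * α + 1) + 1) / 8)
      ≡ 0 [ZMOD 3 ^ (3 * α + β + 2)] ∧
    ∀ (k p : ℕ) [Fact p.Prime], legendreSym p (-3) = -1 → ¬ p ∣ n →
      twoColorTriples (3 ^ (2 * α + 1))
          (3 ^ (2 * α + β + 1) * p ^ (2 * k + 1) * n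
            + (4 * p ^ (2 * k + 2) * 3 ^ (2 * α + β + 1) + 3 ^ (2 * α + 1) + 1) / 8)
        ≡ 0 [ZMOD 3 ^ (3 * α + β + 4)] := by
  have h8 := Nat.mul_div_cancel' (eight_dvd_offset α β 1 odd_one)
  rw [mul_one] at h8
  constructor
  · obtain ⟨w, hw, h⟩ := twoColorTriples_eq α β n _ h8
    obtain ⟨c, d, hcd⟩ := hw.exists_coeff_eq n
    rw [Int.modEq_zero_iff_dvd, h, hcd]
    exact ⟨c * coeff n (eulerE 1 ^ 3 * tri (eulerE 1 ^ 3)) + 9 * d, by ring⟩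
  · have h1 : ((-3 : ℤ) : ZMod 2) = 1 * 1 := by decide
    intro k p _ hp hn
    have hpp : p.Prime := Fact.out
    have hp2 : p ≠ 2 := by
      rintro rfl
      exact (legendreSym.eq_neg_one_iff 2).1 hp ⟨1, h1⟩
    have hodd : Odd p := hpp.odd_of_ne_two hp2
    have h8' := Nat.mul_div_cancel' (eight_dvd_offset α β (p ^ (2 * k + 2)) hodd.pow)
    obtain ⟨d, hd⟩ : Odd (p ^ (2 * k + 2)) := hodd.pow
    have hi : 3 ^ (2 * α + β + 1) * p ^ (2 * k + 1) * n
        + (4 * p ^ (2 * k + 2) * 3 ^ (2 * α + β + 1) + 3 ^ (2 * α + 1) + 1) / 8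
        = 3 ^ (2 * α + β + 1) * (p ^ (2 * k + 1) * n + d)
          + (4 * 3 ^ (2 * α + β + 1) + 3 ^ (2 * α + 1) + 1) / 8 := by
      rw [hd] at h8' ⊢
      nlinarith
    obtain ⟨w, hw, h⟩ := twoColorTriples_eq α β (p ^ (2 * k + 1) * n + d) _ h8
    obtain ⟨c, e, hce⟩ := hw.exists_coeff_eq (p ^ (2 * k + 1) * n + d)
    have h0 : coeff (p ^ (2 * k + 1) * n + d) (eulerE 1 ^ 3 * tri (eulerE 1 ^ 3)) = 0 := by
      by_contra hne
      obtain ⟨x, y, hxy⟩ := exists_sq_add_three_mul_sq hne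
      -- At N = p^(2k+1)n + d with 2d + 1 = p^(2k+2), one has 4(2N + 1) = p^(2k+1)·4(2n + p).
      have hm : ¬ (p : ℤ) ∣ 4 * (2 * n + p) := by
        intro hdvd
        have hdvd : p ∣ 4 * (2 * n + p) := by exact_mod_cast hdvd
        have h2 : ¬ p ∣ 2 := fun h => hp2 ((Nat.prime_dvd_prime_iff_eq hpp Nat.prime_two).1 h)
        rcases hpp.dvd_mul.1 hdvd with h | h
        · exact h2 (hpp.dvd_of_dvd_pow (show p ∣ 2 ^ 2 from h))
        · rcases hpp.dvd_mul.1 ((Nat.dvd_add_left (dvd_refl p)).1 h) with h | h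
          · exact h2 h
          · exact hn h
      refine sq_add_three_mul_sq_ne hp hm k x y ?_
      rw [← hxy]
      have hd' : (p : ℤ) ^ (2 * k + 2) = 2 * d + 1 := by exact_mod_cast hd
      push_cast
      linear_combination 4 * hd'
    rw [hi, Int.modEq_zero_iff_dvd, h, hce, h0]
    exact ⟨e, by ring⟩
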